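/- Let $\alpha,\beta,\gamma>-1$ with $\alpha\ne\beta$, let $\sigma>0$, and write $w_{a,c}(x)=x^a(1-x)^c$ on $[0,1]$, $c_{a,c}=\big(\int_0^1 w_{a,c}(x)\,dx\big)^{-1}$, and $(a)_n=a(a+1)\cdots(a+n-1)$. For $f,g\in\mathbb R[x,y]$ put $$\langle f,g\rangle=c_{\alpha,\gamma}\int_0^1 f(x,1)g(x,1)w_{\alpha,\gamma}(x)\,dx+\sigma\,c_{\beta,\gamma}\int_0^1 f(1,y)g(1,y)w_{\beta,\gamma}(y)\,dy .$$ This form vanishes on the ideal $I=\langle(1-x)(1-y)\rangle$. Call a polynomial $p$ of total degree at most $n$ *orthogonal of degree $n$* if $\langle p,g\rangle=0$ for every polynomial $g$ of total degree less than $n$, and let $\mathcal H_n\subset\mathbb R[x,y]/I$ be the space of classes of such polynomials. Let $P_n^{(a,b)}$ be the usual Jacobi polynomials on $[-1,1]$, normalized by $P_n^{(a,b)}(1)=\binom{n+a}{n}$, let $$h_n^{a,c}=c_{a,c}\int_0^1\big[P_n^{(c,a)}(2x-1)\big]^2w_{a,c}(x)\,dx ,$$ and for $n\ge1$ let $$P_n(x,y)=P_n^{(\gamma,\alpha)}(2x-1)+P_n^{(\gamma,\beta)}(2y-1)-\binom{n+\gamma}{n},$$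 $$Q_n(x,y)=\frac{(\gamma+\alpha+2)_n}{(\alpha+1)_{n-1}}(1-x)P_{n-1}^{(\gamma+2,\alpha)}(2x-1)-\sigma^{-1}\frac{(\gamma+\beta+2)_n}{(\beta+1)_{n-1}}(1-y)P_{n-1}^{(\gamma+2,\beta)}(2y-1),$$ $$R_n=Q_n-\frac{\langle P_n,Q_n\rangle}{h_n^{\alpha,\gamma}+\sigma h_n^{\beta,\gamma}}\,P_n .$$ Then, for every $n\ge1$, $P_n$ and $R_n$ are orthogonal of degree $n$, $\langle P_n,R_n\rangle=0$, and the classes of $P_n,R_n$ form a basis of $\mathcal H_n$. Moreover $$\langle R_n,R_n\rangle=\langle Q_n,Q_n\rangle-\frac{\langle P_n,Q_n\rangle^2}{\langle P_n,P_n\rangle},$$ where $$\langle P_n,Q_n\rangle=\frac{(\beta-\alpha)(\gamma+1)_{n+1}}{(2n+\gamma+\alpha+1)(2n+\gamma+\beta+1)(n-1)!},\qquad \langle P_n,P_n\rangle=h_n^{\alpha,\gamma}+\sigma h_n^{\beta,\gamma},$$ $$\langle Q_n,Q_n\rangle=\frac{(\gamma+1)_2(\alpha+\gamma+2)_n^2}{(\alpha+\gamma+2)_2(\alpha+1)_{n-1}^2}h_{n-1}^{\alpha,\gamma+2}+\sigma^{-1}\frac{(\gamma+1)_2(\beta+\gamma+2)_n^2}{(\beta+\gamma+2)_2(\beta+1)_{n-1}^2}h_{n-1}^{\beta,\gamma+2},$$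 and each of the four numbers $h_k^{a,c}$ occurring here, namely $h_n^{\alpha,\gamma}$, $h_n^{\beta,\gamma}$, $h_{n-1}^{\alpha,\gamma+2}$, $h_{n-1}^{\beta,\gamma+2}$, is given by $$h_k^{a,c}=\frac{(c+1)_k(a+1)_k(k+c+a+1)}{k!\,(c+a+2)_k(2k+c+a+1)} .$$ -/

import Mathlib

open MeasureTheory

noncomputable section

/-- The Pochhammer symbol (rising factorial) `(a)_n = a (a + 1) ⋯ (a + n - 1)`. -/
def poch (a : ℝ) (n : ℕ) : ℝ := (ascPochhammer ℝ n).eval a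

/-- The usual Jacobi polynomial `P_n^{(a,b)}` on `[-1,1]`, in its hypergeometric form
`P_n^{(a,b)}(z) = (1 / n!) ∑_k (n choose k) (n+a+b+1)_k (a+k+1)_{n-k} ((z-1)/2)^k`, which for
`a > -1` is `((a+1)_n / n!) ₂F₁(-n, n+a+b+1; a+1; (1-z)/2)`. -/
def jacobiPoly (n : ℕ) (a b : ℝ) : Polynomial ℝ :=
  ∑ k ∈ Finset.range (n + 1),
    Polynomial.C ((n.choose k : ℝ) * poch (n + a + b + 1) k * poch (a + k + 1) (n - k)
      / (n.factorial : ℝ)) * (Polynomial.C (1 / 2) * (Polynomial.X - 1)) ^ k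

/-- The Jacobi weight `w_{α,γ}(x) = x^α (1-x)^γ` on `[0,1]`. -/
def jacobiWeight (α γ x : ℝ) : ℝ := x ^ α * (1 - x) ^ γ

/-- The normalisation constant `c_{α,γ} = (∫_0^1 w_{α,γ})⁻¹`. -/
def jacobiConst (α γ : ℝ) : ℝ := (∫ x in (0 : ℝ)..1, jacobiWeight α γ x)⁻¹

/-- `h_n^{α,γ} = c_{α,γ} ∫_0^1 [P_n^{(γ,α)}(2x-1)]² w_{α,γ}(x) dx`. -/
def jacobiNormSq (n : ℕ) (α γ : ℝ) : ℝ :=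
  jacobiConst α γ *
    ∫ x in (0 : ℝ)..1, ((jacobiPoly n γ α).eval (2 * x - 1)) ^ 2 * jacobiWeight α γ x

/-- Value of a polynomial in two variables at the point `(x, y)`. -/
def evalXY (f : MvPolynomial (Fin 2) ℝ) (x y : ℝ) : ℝ := MvPolynomial.eval ![x, y] f

/-- The Jacobi-type bilinear form on the wedge `{(x,1)} ∪ {(1,y)}`, `x, y ∈ [0,1]`. -/
def wedgeInner (α β γ σ : ℝ) (f g : MvPolynomial (Fin 2) ℝ) : ℝ :=
  jacobiConst α γ * (∫ x in (0 : ℝ)..1, evalXY f x 1 * evalXY g x 1 * jacobiWeight α γ x)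
  + σ * jacobiConst β γ *
      (∫ y in (0 : ℝ)..1, evalXY f 1 y * evalXY g 1 y * jacobiWeight β γ y)

/-- The ideal of `ℝ[x,y]` generated by `(1-x)(1-y)`. -/
def wedgeIdeal : Ideal (MvPolynomial (Fin 2) ℝ) :=
  Ideal.span {(1 - MvPolynomial.X 0) * (1 - MvPolynomial.X 1)}

theorem evalXY_eq_zero_of_mem_wedgeIdeal {f : MvPolynomial (Fin 2) ℝ} (hf : f ∈ wedgeIdeal) :
    (∀ x, evalXY f x 1 = 0) ∧ ∀ y, evalXY f 1 y = 0 := by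
  obtain ⟨g, rfl⟩ := Ideal.mem_span_singleton'.1 hf
  simp [evalXY]

/-- The form does not see elements of the ideal, so orthogonality makes sense modulo the ideal. -/
theorem wedgeInner_eq_zero_of_mem_wedgeIdeal (α β γ σ : ℝ) {f : MvPolynomial (Fin 2) ℝ}
    (hf : f ∈ wedgeIdeal) (g : MvPolynomial (Fin 2) ℝ) : wedgeInner α β γ σ f g = 0 := by
  obtain ⟨h1, h2⟩ := evalXY_eq_zero_of_mem_wedgeIdeal hf
  simp [wedgeInner, h1, h2]

theorem intervalIntegrable_jacobiWeight {α γ : ℝ} (hα : -1 < α) (hγ : -1 < γ) :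
    IntervalIntegrable (jacobiWeight α γ) volume 0 1 := by
  have h := (Complex.betaIntegral_convergent (u := ((α + 1 : ℝ) : ℂ)) (v := ((γ + 1 : ℝ) : ℂ))
    (by rw [Complex.ofReal_re]; linarith) (by rw [Complex.ofReal_re]; linarith)).norm
  refine h.congr_ae ?_
  rw [Set.uIoc_of_le zero_le_one, ← restrict_Ioo_eq_restrict_Ioc]
  filter_upwards [ae_restrict_mem measurableSet_Ioo] with x hx
  have hx1 : 0 < 1 - x := by linarith [hx.2]
  have e : (1 : ℂ) - (x : ℂ) = ((1 - x : ℝ) : ℂ) := by push_cast; ring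
  rw [norm_mul, e, Complex.norm_cpow_eq_rpow_re_of_pos hx.1,
    Complex.norm_cpow_eq_rpow_re_of_pos hx1]
  simp [jacobiWeight]

theorem continuous_evalXY (f : MvPolynomial (Fin 2) ℝ) {u v : ℝ → ℝ} (hu : Continuous u)
    (hv : Continuous v) : Continuous fun t => evalXY f (u t) (v t) := by
  unfold evalXY
  refine (MvPolynomial.continuous_eval f).comp (continuous_pi fun i => ?_)
  fin_cases i <;> simpa

theorem intervalIntegrable_evalXY {α γ : ℝ} (hα : -1 < α) (hγ : -1 < γ)
    (f g : MvPolynomial (Fin 2) ℝ) {u v : ℝ → ℝ} (hu : Continuous u) (hv : Continuous v) :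
    IntervalIntegrable (fun t => evalXY f (u t) (v t) * evalXY g (u t) (v t) *
      jacobiWeight α γ t) volume 0 1 :=
  (intervalIntegrable_jacobiWeight hα hγ).continuousOn_mul
    ((continuous_evalXY f hu hv).mul (continuous_evalXY g hu hv)).continuousOn

theorem wedgeInner_add_left {α β γ : ℝ} (hα : -1 < α) (hβ : -1 < β) (hγ : -1 < γ) (σ : ℝ)
    (f g h : MvPolynomial (Fin 2) ℝ) :
    wedgeInner α β γ σ (f + g) h = wedgeInner α β γ σ f h + wedgeInner α β γ σ g h := by
  have e : ∀ x y, evalXY (f + g) x y = evalXY f x y + evalXY g x y := by simp [evalXY]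
  simp only [wedgeInner, e, add_mul]
  rw [intervalIntegral.integral_add, intervalIntegral.integral_add]
  · ring
  · exact intervalIntegrable_evalXY hβ hγ f h continuous_const continuous_id
  · exact intervalIntegrable_evalXY hβ hγ g h continuous_const continuous_id
  · exact intervalIntegrable_evalXY hα hγ f h continuous_id continuous_const
  · exact intervalIntegrable_evalXY hα hγ g h continuous_id continuous_const

theorem wedgeInner_smul_left (α β γ σ c : ℝ) (f h : MvPolynomial (Fin 2) ℝ) :
    wedgeInner α β γ σ (c • f) h = c * wedgeInner α β γ σ f h := by
  have e : ∀ x y, evalXY (c • f) x y = c * evalXY f x y := by simp [evalXY]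
  simp only [wedgeInner, e, mul_assoc, intervalIntegral.integral_const_mul]
  ring

/-- Polynomials of total degree at most `n` that are orthogonal to all polynomials of total degree
less than `n` (the hypotheses on the parameters make the form bilinear). -/
def wedgeOrthPolys {α β γ : ℝ} (hα : -1 < α) (hβ : -1 < β) (hγ : -1 < γ) (σ : ℝ) (n : ℕ) :
    Submodule ℝ (MvPolynomial (Fin 2) ℝ) where
  carrier := {p | p.totalDegree ≤ n ∧
    ∀ g : MvPolynomial (Fin 2) ℝ, g.totalDegree < n → wedgeInner α β γ σ p g = 0}
  zero_mem' := ⟨by simp, fun g _ => by simp [wedgeInner, evalXY]⟩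
  add_mem' := by
    rintro p q ⟨hp, hp'⟩ ⟨hq, hq'⟩
    exact ⟨(MvPolynomial.totalDegree_add p q).trans (max_le hp hq), fun g hg => by
      rw [wedgeInner_add_left hα hβ hγ, hp' g hg, hq' g hg, add_zero]⟩
  smul_mem' := by
    rintro c p ⟨hp, hp'⟩
    exact ⟨(MvPolynomial.totalDegree_smul_le c p).trans hp, fun g hg => by
      rw [wedgeInner_smul_left, hp' g hg, mul_zero]⟩

/-- The space of orthogonal polynomials of degree `n` in `ℝ[x,y]/⟨(1-x)(1-y)⟩`. -/
def wedgeOrthSpace {α β γ : ℝ} (hα : -1 < α) (hβ : -1 < β) (hγ : -1 < γ) (σ : ℝ) (n : ℕ) :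
    Submodule ℝ (MvPolynomial (Fin 2) ℝ ⧸ wedgeIdeal) :=
  (wedgeOrthPolys hα hβ hγ σ n).map (Ideal.Quotient.mkₐ ℝ wedgeIdeal).toLinearMap

/-- `P_n^{(a,b)}(2t - 1)` as a bivariate polynomial, `t` being the coordinate number `i`. -/
def shiftedJacobi (n : ℕ) (a b : ℝ) (i : Fin 2) : MvPolynomial (Fin 2) ℝ :=
  Polynomial.aeval (2 * MvPolynomial.X i - 1 : MvPolynomial (Fin 2) ℝ) (jacobiPoly n a b)

/-- `P_n(x,y) = P_n^{(γ,α)}(2x-1) + P_n^{(γ,β)}(2y-1) - binom(n+γ, n)`. -/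
def wedgeP (α β γ : ℝ) (n : ℕ) : MvPolynomial (Fin 2) ℝ :=
  shiftedJacobi n γ α 0 + shiftedJacobi n γ β 1 - MvPolynomial.C (Ring.choose ((n : ℝ) + γ) n)

/-- `Q_n`, meant for `n ≥ 1`. -/
def wedgeQ (α β γ σ : ℝ) (n : ℕ) : MvPolynomial (Fin 2) ℝ :=
  MvPolynomial.C (poch (γ + α + 2) n / poch (α + 1) (n - 1)) *
      ((1 - MvPolynomial.X 0) * shiftedJacobi (n - 1) (γ + 2) α 0)
  - MvPolynomial.C (σ⁻¹ * (poch (γ + β + 2) n / poch (β + 1) (n - 1))) *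
      ((1 - MvPolynomial.X 1) * shiftedJacobi (n - 1) (γ + 2) β 1)

/-- `R_n = Q_n - ⟨P_n,Q_n⟩ / (h_n^{α,γ} + σ h_n^{β,γ}) P_n`. -/
def wedgeR (α β γ σ : ℝ) (n : ℕ) : MvPolynomial (Fin 2) ℝ :=
  wedgeQ α β γ σ n -
    MvPolynomial.C (wedgeInner α β γ σ (wedgeP α β γ n) (wedgeQ α β γ σ n) /
      (jacobiNormSq n α γ + σ * jacobiNormSq n β γ)) * wedgeP α β γ n

/-- The closed form `(γ+1)_n (α+1)_n (n+γ+α+1) / (n! (γ+α+2)_n (2n+γ+α+1))`. -/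
def jacobiNormValue (n : ℕ) (α γ : ℝ) : ℝ :=
  poch (γ + 1) n * poch (α + 1) n * (n + γ + α + 1) /
    (n.factorial * poch (γ + α + 2) n * (2 * n + γ + α + 1))

end

/-! ### Rising factorials -/

/-! Modulo the ideal a polynomial is the pair of its restrictions f(x,1), f(1,y), two univariate
polynomials that agree at 1 (`mem_wedgeIdeal_iff`), and the form is a weighted sum of two Jacobi
means (`wedgeInner_eq_jacobiMean`). So everything is univariate, apart from the coupling at the
corner.

P_n restricts to a Jacobi polynomial on each leg and is orthogonal leg by leg. On a leg, Q_n is a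
multiple of (1-x)P_m^{(γ+2,α)} with m = n-1. Writing g = g(1) + (1-x)q and moving (1-x)² into the
weight shows that its mean against g of degree at most m sees only g(1). The normalisation makes
this mean (γ+1)g(1) on either leg (`jacobiMean_legQ_mul`), so the legs cancel. R_n is the
Gram–Schmidt correction of Q_n.

For spanning, the leading coefficients of P_n on the legs have equal signs and those of Q_n opposite
signs, so a combination of the two matches both top coefficients of any orthogonal f. The remainder
has a representative of lower total degree, is therefore orthogonal to itself, and vanishes by
definiteness. The explicit values come from `jacobiMean_mul_unitJacobi`: only the leading
coefficient survives against a Jacobi polynomial, a consequence of Chu–Vandermonde. -/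

@[simp] theorem poch_zero (a : ℝ) : poch a 0 = 1 := by simp [poch]

theorem poch_succ (a : ℝ) (n : ℕ) : poch a (n + 1) = poch a n * (a + n) := by
  simp [poch, ascPochhammer_succ_eval]

theorem poch_add (a : ℝ) (m k : ℕ) : poch a (m + k) = poch a m * poch (a + m) k := by
  induction k with
  | zero => simp
  | succ k ih => rw [← add_assoc, poch_succ, ih, poch_succ]; push_cast; ring

theorem poch_succ_left (a : ℝ) (n : ℕ) : poch a (n + 1) = a * poch (a + 1) n := by
  rw [add_comm, poch_add, poch_succ]; simp

theorem poch_pos {a : ℝ} (ha : 0 < a) (n : ℕ) : 0 < poch a n := ascPochhammer_pos n a ha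

theorem poch_one (n : ℕ) : poch 1 n = n.factorial := by
  simp [poch, ascPochhammer_eval_one]

/-- The n consecutive factors run from j+1-n up to j and pass through 0. Orthogonality of Jacobi
polynomials to lower powers rests on this. -/
theorem poch_sub_eq_zero {n j : ℕ} (h : j < n) : poch ((j : ℝ) + 1 - n) n = 0 := by
  refine (ascPochhammer_eval_eq_zero_iff n _).2 ⟨n - 1 - j, by omega, ?_⟩
  rw [Nat.sub_sub, Nat.cast_sub (by omega)]
  push_cast
  ring

theorem ringChoose_eq_poch (γ : ℝ) (n : ℕ) :
    Ring.choose ((n : ℝ) + γ) n = poch (γ + 1) n / n.factorial := by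
  have h := Ring.descPochhammer_eq_factorial_smul_choose ((n : ℝ) + γ) n
  rw [Polynomial.descPochhammer_smeval_eq_ascPochhammer, Polynomial.ascPochhammer_smeval_eq_eval,
    show (n : ℝ) + γ - n + 1 = γ + 1 by ring, nsmul_eq_mul] at h
  rw [poch, h, mul_div_cancel_left₀ _ (by exact_mod_cast n.factorial_ne_zero)]

/-- Pascal's rule, in the form needed for the induction in `chu_vandermonde`. -/
theorem sum_alternating_choose_succ (f : ℕ → ℝ) (n : ℕ) :
    ∑ k ∈ Finset.range (n + 2), (-1 : ℝ) ^ k * ((n + 1).choose k : ℝ) * f k =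
      ∑ k ∈ Finset.range (n + 1), (-1 : ℝ) ^ k * (n.choose k : ℝ) * f k -
        ∑ k ∈ Finset.range (n + 1), (-1 : ℝ) ^ k * (n.choose k : ℝ) * f (k + 1) := by
  rw [Finset.sum_range_succ']
  have h : ∑ k ∈ Finset.range (n + 1), (-1 : ℝ) ^ k * (n.choose k : ℝ) * f k =
      ∑ k ∈ Finset.range (n + 1), (-1 : ℝ) ^ (k + 1) * (n.choose (k + 1) : ℝ) * f (k + 1) +
        f 0 := by
    have e := Finset.sum_range_succ' (fun k => (-1 : ℝ) ^ k * (n.choose k : ℝ) * f k) (n + 1)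
    rw [Finset.sum_range_succ] at e
    simpa using e
  rw [h, add_sub_right_comm, ← Finset.sum_sub_distrib]
  congr 1
  · refine Finset.sum_congr rfl fun k _ => ?_
    rw [Nat.choose_succ_succ]
    push_cast
    ring
  · simp

/-- The Chu–Vandermonde identity `₂F₁(-n, a; c; 1) = (c - a)_n / (c)_n`. -/
theorem chu_vandermonde (n : ℕ) (a : ℝ) {c : ℝ} (hc : 0 < c) :
    ∑ k ∈ Finset.range (n + 1), (-1 : ℝ) ^ k * (n.choose k : ℝ) * (poch a k / poch c k) =
      poch (c - a) n / poch c n := by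
  induction n generalizing a c with
  | zero => simp
  | succ n ih =>
    rw [sum_alternating_choose_succ, ih a hc]
    have hc1 : 0 < c + 1 := by linarith
    -- The shifted sum is a/c times the same sum at (a+1, c+1), which leaves c - a unchanged; hence
    -- the induction over all a and c.
    have e : ∀ k, poch a (k + 1) / poch c (k + 1) =
        a / c * (poch (a + 1) k / poch (c + 1) k) := fun k => by
      rw [poch_succ_left, poch_succ_left, mul_div_mul_comm]
    simp only [e]
    have : ∀ k ∈ Finset.range (n + 1), (-1 : ℝ) ^ k * (n.choose k : ℝ) *
        (a / c * (poch (a + 1) k / poch (c + 1) k)) =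
        a / c * ((-1 : ℝ) ^ k * (n.choose k : ℝ) * (poch (a + 1) k / poch (c + 1) k)) :=
      fun k _ => by ring
    rw [Finset.sum_congr rfl this, ← Finset.mul_sum, ih (a + 1) hc1,
      show c + 1 - (a + 1) = c - a by ring, poch_succ (c - a), div_mul_div_comm,
      ← poch_succ_left, poch_succ c]
    have h1 := (poch_pos hc n).ne'
    have h2 : c + n ≠ 0 := by positivity
    field_simp
    ring

/-! ### Moments of the normalised Jacobi weight -/

theorem integral_jacobiWeight {α γ : ℝ} (hα : -1 < α) (hγ : -1 < γ) :
    ∫ x in (0 : ℝ)..1, jacobiWeight α γ x = ProbabilityTheory.beta (α + 1) (γ + 1) := by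
  have hα' : 0 < α + 1 := by linarith
  have hγ' : 0 < γ + 1 := by linarith
  rw [ProbabilityTheory.beta_eq_betaIntegralReal _ _ hα' hγ', Complex.betaIntegral]
  have e : ∫ x in (0 : ℝ)..1, (x : ℂ) ^ (((α + 1 : ℝ) : ℂ) - 1) *
      (1 - (x : ℂ)) ^ (((γ + 1 : ℝ) : ℂ) - 1) =
      ∫ x in (0 : ℝ)..1, ((jacobiWeight α γ x : ℝ) : ℂ) := by
    refine intervalIntegral.integral_congr fun x hx => ?_
    rw [Set.uIcc_of_le zero_le_one] at hx
    have h1 : 0 ≤ 1 - x := by linarith [hx.2]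
    simp only [jacobiWeight, Complex.ofReal_mul, Complex.ofReal_cpow hx.1,
      Complex.ofReal_cpow h1]
    simp
  rw [e, intervalIntegral.integral_ofReal, Complex.ofReal_re]

theorem jacobiConst_eq {α γ : ℝ} (hα : -1 < α) (hγ : -1 < γ) :
    jacobiConst α γ = (ProbabilityTheory.beta (α + 1) (γ + 1))⁻¹ := by
  rw [jacobiConst, integral_jacobiWeight hα hγ]

theorem jacobiConst_pos {α γ : ℝ} (hα : -1 < α) (hγ : -1 < γ) : 0 < jacobiConst α γ := by
  rw [jacobiConst_eq hα hγ]
  exact inv_pos.2 (ProbabilityTheory.beta_pos (by linarith) (by linarith))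

theorem Gamma_add_natCast {a : ℝ} (ha : 0 < a) (k : ℕ) :
    Real.Gamma (a + k) = poch a k * Real.Gamma a := by
  induction k with
  | zero => simp
  | succ k ih =>
    rw [Nat.cast_succ, ← add_assoc, Real.Gamma_add_one (by positivity), ih, poch_succ]
    ring

theorem beta_add_natCast {a b : ℝ} (ha : 0 < a) (hb : 0 < b) (j k : ℕ) :
    ProbabilityTheory.beta (a + j) (b + k) =
      poch a j * poch b k / poch (a + b) (j + k) * ProbabilityTheory.beta a b := by
  rw [ProbabilityTheory.beta, ProbabilityTheory.beta, Gamma_add_natCast ha, Gamma_add_natCast hb,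
    show a + j + (b + k) = a + b + (j + k : ℕ) by push_cast; ring,
    Gamma_add_natCast (by positivity)]
  have := (poch_pos (add_pos ha hb) (j + k)).ne'
  have := (Real.Gamma_pos_of_pos (add_pos ha hb)).ne'
  field_simp

theorem intervalIntegrable_eval_mul_jacobiWeight {α γ : ℝ} (hα : -1 < α) (hγ : -1 < γ)
    (p : Polynomial ℝ) :
    IntervalIntegrable (fun x => p.eval x * jacobiWeight α γ x) volume 0 1 :=
  (intervalIntegrable_jacobiWeight hα hγ).continuousOn_mul p.continuous.continuousOn

/-- The mean of a polynomial with respect to the normalised Jacobi weight. -/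
noncomputable def jacobiMean {α γ : ℝ} (hα : -1 < α) (hγ : -1 < γ) : Polynomial ℝ →ₗ[ℝ] ℝ where
  toFun p := jacobiConst α γ * ∫ x in (0 : ℝ)..1, p.eval x * jacobiWeight α γ x
  map_add' p q := by
    simp only [Polynomial.eval_add, add_mul]
    rw [intervalIntegral.integral_add (intervalIntegrable_eval_mul_jacobiWeight hα hγ p)
      (intervalIntegrable_eval_mul_jacobiWeight hα hγ q), mul_add]
  map_smul' c p := by
    simp only [Polynomial.eval_smul, smul_eq_mul, mul_assoc, intervalIntegral.integral_const_mul,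
      RingHom.id_apply]
    ring

theorem jacobiMean_apply {α γ : ℝ} (hα : -1 < α) (hγ : -1 < γ) (p : Polynomial ℝ) :
    jacobiMean hα hγ p =
      jacobiConst α γ * ∫ x in (0 : ℝ)..1, p.eval x * jacobiWeight α γ x := rfl

open Polynomial in
theorem jacobiMean_X_pow_mul_one_sub_X_pow {α γ : ℝ} (hα : -1 < α) (hγ : -1 < γ) (j k : ℕ) :
    jacobiMean hα hγ (X ^ j * (1 - X) ^ k) =
      poch (α + 1) j * poch (γ + 1) k / poch (γ + α + 2) (j + k) := by
  have hα' : 0 < α + 1 := by linarith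
  have hγ' : 0 < γ + 1 := by linarith
  have hj : (0 : ℝ) ≤ j := j.cast_nonneg
  have hk : (0 : ℝ) ≤ k := k.cast_nonneg
  -- Away from the endpoints both bases are nonzero, so the integer powers merge with the real
  -- exponents.
  have e : ∫ x in (0 : ℝ)..1, (X ^ j * (1 - X) ^ k : ℝ[X]).eval x * jacobiWeight α γ x =
      ∫ x in (0 : ℝ)..1, jacobiWeight (α + j) (γ + k) x := by
    rw [intervalIntegral.integral_of_le zero_le_one, intervalIntegral.integral_of_le zero_le_one,
      integral_Ioc_eq_integral_Ioo, integral_Ioc_eq_integral_Ioo]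
    refine setIntegral_congr_fun measurableSet_Ioo fun x hx => ?_
    have h1 : 1 - x ≠ 0 := by linarith [hx.2]
    simp only [jacobiWeight, Real.rpow_add_natCast hx.1.ne', Real.rpow_add_natCast h1, eval_mul,
      eval_pow, eval_X, eval_sub, eval_one]
    ring
  rw [jacobiMean_apply, e, integral_jacobiWeight (by linarith) (by linarith), jacobiConst_eq hα hγ,
    add_right_comm, add_right_comm γ, beta_add_natCast hα' hγ',
    show α + 1 + (γ + 1) = γ + α + 2 by ring]
  have := (ProbabilityTheory.beta_pos hα' hγ').ne'
  field_simp

open Polynomial in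
/-- A factor `(1 - x)^k` may be absorbed in the weight. -/
theorem jacobiMean_one_sub_X_pow_mul {α γ γ' : ℝ} (hα : -1 < α) (hγ : -1 < γ) (hγ' : -1 < γ')
    {k : ℕ} (h : γ' = γ + k) (p : ℝ[X]) :
    jacobiMean hα hγ ((1 - X) ^ k * p) =
      poch (γ + 1) k / poch (γ + α + 2) k * jacobiMean hα hγ' p := by
  -- By linearity monomials suffice, and there the claim is the splitting of (γ+α+2)_{k+j}.
  induction p using Polynomial.induction_on' with
  | add p q hp hq => rw [mul_add, map_add, hp, hq, map_add, mul_add]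
  | monomial j a =>
    have hX : jacobiMean hα hγ' (X ^ j) = poch (α + 1) j / poch (γ' + α + 2) j := by
      simpa using jacobiMean_X_pow_mul_one_sub_X_pow hα hγ' j 0
    rw [← C_mul_X_pow_eq_monomial, ← smul_eq_C_mul, mul_smul_comm, map_smul, map_smul, mul_comm,
      jacobiMean_X_pow_mul_one_sub_X_pow, hX, add_comm j k, poch_add (γ + α + 2),
      show γ + α + 2 + k = γ' + α + 2 by rw [h]; ring]
    simp only [smul_eq_mul]
    have := (poch_pos (show 0 < γ + α + 2 by linarith) k).ne'
    have := (poch_pos (show 0 < γ' + α + 2 by linarith) j).ne'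
    field_simp

open Polynomial in
theorem jacobiMean_sq_nonneg {α γ : ℝ} (hα : -1 < α) (hγ : -1 < γ) (p : ℝ[X]) :
    0 ≤ jacobiMean hα hγ (p * p) := by
  refine mul_nonneg (jacobiConst_pos hα hγ).le
    (intervalIntegral.integral_nonneg zero_le_one fun x hx => ?_)
  have h1 : 0 ≤ 1 - x := by linarith [hx.2]
  rw [eval_mul, jacobiWeight]
  exact mul_nonneg (mul_self_nonneg _)
    (mul_nonneg (Real.rpow_nonneg hx.1 _) (Real.rpow_nonneg h1 _))

open Polynomial in
-- The nonnegative integrand vanishes almost everywhere while the weight is positive on (0,1). A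
-- nonzero p has finitely many roots, which would make (0,1) a null set.
theorem eq_zero_of_jacobiMean_sq_eq_zero {α γ : ℝ} (hα : -1 < α) (hγ : -1 < γ) {p : ℝ[X]}
    (hp : jacobiMean hα hγ (p * p) = 0) : p = 0 := by
  have hpos : ∀ x ∈ Set.Ioo (0 : ℝ) 1, 0 < jacobiWeight α γ x := fun x hx =>
    mul_pos (Real.rpow_pos_of_pos hx.1 _) (Real.rpow_pos_of_pos (by linarith [hx.2]) _)
  rw [jacobiMean_apply, mul_eq_zero, or_iff_right (jacobiConst_pos hα hγ).ne',
    intervalIntegral.integral_of_le zero_le_one, integral_Ioc_eq_integral_Ioo] at hp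
  have hi := intervalIntegrable_eval_mul_jacobiWeight hα hγ (p * p)
  rw [intervalIntegrable_iff_integrableOn_Ioo_of_le zero_le_one] at hi
  rw [setIntegral_eq_zero_iff_of_nonneg_ae ?_ hi, Filter.EventuallyEq,
    ae_restrict_iff' measurableSet_Ioo] at hp
  · by_contra h0
    have hfin : ({x | x ∈ p.roots.toFinset} : Set ℝ).Finite := Finset.finite_toSet _
    have hz : volume (Set.Ioo (0 : ℝ) 1) = 0 := by
      refine measure_mono_null (t := {x | x ∈ p.roots.toFinset} ∪
        {x | ¬ (x ∈ Set.Ioo (0 : ℝ) 1 → (p * p).eval x * jacobiWeight α γ x = 0)})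
        (fun x hx => ?_) (measure_union_null (hfin.measure_zero volume) (ae_iff.1 hp))
      by_cases hr : p.eval x = 0
      · exact Or.inl (by simp [h0, hr])
      · exact Or.inr fun hx' => by simpa [hr, (hpos x hx).ne'] using hx' hx
    simp at hz
  · filter_upwards [ae_restrict_mem measurableSet_Ioo] with x hx
    rw [eval_mul]
    exact mul_nonneg (mul_self_nonneg _) (hpos x hx).le

/-! ### Jacobi polynomials on `[0, 1]` -/

section Univariate

open Polynomial

/-- The univariate polynomial `P_n^{(a,b)}(2t - 1)`. -/
noncomputable def unitJacobi (n : ℕ) (a b : ℝ) : ℝ[X] := (jacobiPoly n a b).comp (2 * X - 1)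

theorem unitJacobi_eq (n : ℕ) (a b : ℝ) :
    unitJacobi n a b = ∑ k ∈ Finset.range (n + 1),
      C ((n.choose k : ℝ) * poch (n + a + b + 1) k * poch (a + k + 1) (n - k) /
        (n.factorial : ℝ)) * (X - 1) ^ k := by
  rw [unitJacobi, jacobiPoly, ← coe_compRingHom_apply, map_sum]
  refine Finset.sum_congr rfl fun k _ => ?_
  have h : (C (1 / 2) * (2 * X - 1 - 1) : ℝ[X]) = X - 1 := by
    have h2 : (C (1 / 2) * 2 : ℝ[X]) = 1 := by
      rw [← C_ofNat, ← C_mul]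
      norm_num
    linear_combination (X - 1) * h2
  simp only [coe_compRingHom_apply, mul_comp, C_comp, pow_comp, sub_comp, X_comp, one_comp, h]

theorem natDegree_X_sub_one_pow (n : ℕ) : ((X - 1 : ℝ[X]) ^ n).natDegree = n := by
  rw [natDegree_pow, ← C_1, natDegree_X_sub_C, mul_one]

theorem unitJacobi_natDegree_le (n : ℕ) (a b : ℝ) : (unitJacobi n a b).natDegree ≤ n := by
  rw [unitJacobi_eq]
  refine natDegree_sum_le_of_forall_le _ _ fun k hk => (natDegree_C_mul_le _ _).trans ?_
  rw [natDegree_X_sub_one_pow]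
  exact Nat.lt_succ_iff.1 (Finset.mem_range.1 hk)

theorem unitJacobi_coeff (n : ℕ) (a b : ℝ) :
    (unitJacobi n a b).coeff n = poch (n + a + b + 1) n / n.factorial := by
  rw [unitJacobi_eq, finsetSum_coeff, Finset.sum_range_succ, Finset.sum_eq_zero, zero_add,
    coeff_C_mul]
  · have h := (monic_X_sub_C (1 : ℝ)).pow n
    rw [C_1, Monic, leadingCoeff, natDegree_X_sub_one_pow] at h
    simp [h]
  · intro k hk
    rw [coeff_C_mul, coeff_eq_zero_of_natDegree_lt, mul_zero]
    rw [natDegree_X_sub_one_pow]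
    exact Finset.mem_range.1 hk

theorem unitJacobi_coeff_pos {n : ℕ} {a b : ℝ} (h : 0 < n + a + b + 1) :
    0 < (unitJacobi n a b).coeff n := by
  rw [unitJacobi_coeff]
  exact div_pos (poch_pos h n) (by exact_mod_cast n.factorial_pos)

theorem unitJacobi_eval_one (n : ℕ) (a b : ℝ) :
    (unitJacobi n a b).eval 1 = poch (a + 1) n / n.factorial := by
  rw [unitJacobi_eq, eval_finsetSum, Finset.sum_eq_single 0]
  · simp
  · intro k _ hk
    simp [hk]
  · simp

/-- Termwise integration gives a terminating ₂F₁ at 1, summed by Chu–Vandermonde. The last factor is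
0 for j < n and n! for j = n. -/
theorem jacobiMean_X_pow_mul_unitJacobi {α γ : ℝ} (hα : -1 < α) (hγ : -1 < γ) (n j : ℕ) :
    jacobiMean hα hγ (X ^ j * unitJacobi n γ α) =
      poch (α + 1) j * poch (γ + 1) n / (n.factorial * poch (γ + α + 2) (j + n)) *
        poch (j + 1 - n) n := by
  have hc : 0 < γ + α + 2 := by linarith
  have hcj : 0 < γ + α + 2 + j := by positivity
  have hterm : ∀ k ∈ Finset.range (n + 1),
      jacobiMean hα hγ (X ^ j * (C ((n.choose k : ℝ) * poch (n + γ + α + 1) k *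
        poch (γ + k + 1) (n - k) / (n.factorial : ℝ)) * (X - 1) ^ k)) =
      poch (α + 1) j * poch (γ + 1) n / (n.factorial * poch (γ + α + 2) j) *
        ((-1) ^ k * (n.choose k : ℝ) *
          (poch (n + γ + α + 1) k / poch (γ + α + 2 + j) k)) := fun k hk => by
    have hk' : k ≤ n := Nat.lt_succ_iff.1 (Finset.mem_range.1 hk)
    have e1 : poch (γ + 1) n = poch (γ + 1) k * poch (γ + k + 1) (n - k) := by
      conv_lhs => rw [← Nat.add_sub_cancel' hk', poch_add, add_right_comm]
    rw [← neg_sub (1 : ℝ[X]) X, neg_pow, ← C_1, ← C_neg, ← C_pow, ← mul_assoc (C _), ← C_mul,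
      ← smul_eq_C_mul, mul_smul_comm, map_smul, C_1, jacobiMean_X_pow_mul_one_sub_X_pow, e1,
      poch_add (γ + α + 2), smul_eq_mul]
    have := (poch_pos hc j).ne'
    have := (poch_pos hcj k).ne'
    have : (n.factorial : ℝ) ≠ 0 := by exact_mod_cast n.factorial_ne_zero
    field_simp
  rw [unitJacobi_eq, Finset.mul_sum, map_sum, Finset.sum_congr rfl hterm, ← Finset.mul_sum,
    chu_vandermonde n _ hcj, poch_add (γ + α + 2),
    show γ + α + 2 + j - (n + γ + α + 1) = (j : ℝ) + 1 - n by ring]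
  have := (poch_pos hc j).ne'
  have := (poch_pos hcj n).ne'
  field_simp

theorem jacobiMean_mul_unitJacobi {α γ : ℝ} (hα : -1 < α) (hγ : -1 < γ) {n : ℕ} {q : ℝ[X]}
    (hq : q.natDegree ≤ n) :
    jacobiMean hα hγ (q * unitJacobi n γ α) =
      q.coeff n * (poch (α + 1) n * poch (γ + 1) n / poch (γ + α + 2) (n + n)) := by
  conv_lhs => rw [q.as_sum_range_C_mul_X_pow' (Nat.lt_succ_of_le hq)]
  rw [Finset.sum_mul, map_sum, Finset.sum_range_succ, Finset.sum_eq_zero, zero_add]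
  · rw [← smul_eq_C_mul, smul_mul_assoc, map_smul, jacobiMean_X_pow_mul_unitJacobi,
      add_sub_cancel_left, poch_one, smul_eq_mul]
    have : (n.factorial : ℝ) ≠ 0 := by exact_mod_cast n.factorial_ne_zero
    have := (poch_pos (show 0 < γ + α + 2 by linarith) (n + n)).ne'
    field_simp
  · intro j hj
    rw [← smul_eq_C_mul, smul_mul_assoc, map_smul, jacobiMean_X_pow_mul_unitJacobi,
      poch_sub_eq_zero (Finset.mem_range.1 hj), mul_zero, smul_zero]

theorem jacobiMean_mul_unitJacobi_eq_zero {α γ : ℝ} (hα : -1 < α) (hγ : -1 < γ) {n : ℕ} {q : ℝ[X]}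
    (hq : q.natDegree < n) : jacobiMean hα hγ (q * unitJacobi n γ α) = 0 := by
  rw [jacobiMean_mul_unitJacobi hα hγ hq.le, coeff_eq_zero_of_natDegree_lt hq, zero_mul]

theorem jacobiMean_unitJacobi_sq {α γ : ℝ} (hα : -1 < α) (hγ : -1 < γ) (n : ℕ) :
    jacobiMean hα hγ (unitJacobi n γ α * unitJacobi n γ α) = jacobiNormSq n α γ := by
  rw [jacobiMean_apply, jacobiNormSq]
  simp [unitJacobi, sq]

/-- Both (s+n)_n (s+2n) and (s+n)(s+1+n)_n equal (s+n)_{n+1}. It is applied with s = γ+α+1; the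
excluded case s + 2n = 0 can occur only for n = 0. -/
theorem poch_add_self_div {s : ℝ} (hs : 0 < s + 1) {n : ℕ} (h : s + 2 * n ≠ 0) :
    poch (s + n) n / poch (s + 1) (n + n) = (s + n) / (poch (s + 1) n * (s + 2 * n)) := by
  have e : poch (s + n) n * (s + 2 * n) = (s + n) * poch (s + 1 + n) n := by
    rw [add_right_comm, ← poch_succ_left, poch_succ]
    ring
  have := (poch_pos hs n).ne'
  have := (poch_pos (show 0 < s + 1 + n by positivity) n).ne'
  rw [poch_add, div_eq_div_iff (by positivity) (by positivity)]
  linear_combination poch (s + 1) n * e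

theorem jacobiNormSq_eq {α γ : ℝ} (hα : -1 < α) (hγ : -1 < γ) (n : ℕ)
    (h : 2 * n + γ + α + 1 ≠ 0) : jacobiNormSq n α γ = jacobiNormValue n α γ := by
  have h' := poch_add_self_div (s := γ + α + 1) (n := n) (by linarith)
    (by convert h using 1; ring)
  rw [← jacobiMean_unitJacobi_sq hα hγ, jacobiMean_mul_unitJacobi hα hγ
    (unitJacobi_natDegree_le _ _ _), unitJacobi_coeff, jacobiNormValue,
    show (n : ℝ) + γ + α + 1 = γ + α + 1 + n by ring,
    show 2 * (n : ℝ) + γ + α + 1 = γ + α + 1 + 2 * n by ring,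
    show γ + α + 2 = γ + α + 1 + 1 by ring]
  calc _ = poch (γ + 1) n * poch (α + 1) n / n.factorial *
        (poch (γ + α + 1 + n) n / poch (γ + α + 1 + 1) (n + n)) := by ring
    _ = _ := by rw [h', div_mul_div_comm, mul_assoc (n.factorial : ℝ)]

/-! ### Means of (1-x)P_m^{(γ+2,α)}(2x-1) -/

theorem natDegree_one_sub_X_mul_le {m : ℕ} {q : ℝ[X]} (hq : q.natDegree ≤ m) :
    ((1 - X) * q).natDegree ≤ m + 1 := by
  rw [add_comm]
  refine natDegree_mul_le_of_le ?_ hq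
  rw [← natDegree_neg, neg_sub, ← C_1, natDegree_X_sub_C]

theorem coeff_one_sub_X_mul {m : ℕ} {q : ℝ[X]} (hq : q.natDegree ≤ m) :
    ((1 - X) * q).coeff (m + 1) = -q.coeff m := by
  rw [sub_mul, one_mul, coeff_sub, coeff_X_mul, coeff_eq_zero_of_natDegree_lt (by omega), zero_sub]

theorem exists_eq_C_add_one_sub_X_mul {m : ℕ} {g : ℝ[X]} (hg : g.natDegree ≤ m + 1) :
    ∃ q : ℝ[X], q.natDegree ≤ m ∧ g = C (g.eval 1) + (1 - X) * q := by
  refine ⟨-(g /ₘ (X - C 1)), ?_, ?_⟩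
  · rw [natDegree_neg, natDegree_divByMonic _ (monic_X_sub_C 1), natDegree_X_sub_C]
    omega
  · have := modByMonic_add_div g (X - C (1 : ℝ))
    rw [modByMonic_X_sub_C_eq_C_eval] at this
    conv_lhs => rw [← this]
    rw [C_1]
    ring

/-- The polynomial `(1 - x) P_m^{(γ+2,α)}(2x - 1)` only sees the value at `1` of polynomials of
degree at most `m`. -/
theorem jacobiMean_one_sub_X_mul_unitJacobi_mul {α γ : ℝ} (hα : -1 < α) (hγ : -1 < γ) {m : ℕ}
    {g : ℝ[X]} (hg : g.natDegree ≤ m) :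
    jacobiMean hα hγ ((1 - X) * unitJacobi m (γ + 2) α * g) =
      g.eval 1 * jacobiMean hα hγ ((1 - X) * unitJacobi m (γ + 2) α) := by
  rcases m with _ | m
  · rw [eq_C_of_natDegree_le_zero hg, mul_comm, ← smul_eq_C_mul, map_smul, eval_C, smul_eq_mul]
  · obtain ⟨q, hq, e⟩ := exists_eq_C_add_one_sub_X_mul hg
    -- The part (1-X)q of g produces (1-X)², which changes the weight to γ+2; there the Jacobi
    -- polynomial kills q.
    have h2 := jacobiMean_one_sub_X_pow_mul hα hγ (γ' := γ + 2) (by linarith) (k := 2)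
      (by norm_num) (q * unitJacobi (m + 1) (γ + 2) α)
    rw [jacobiMean_mul_unitJacobi_eq_zero _ _ (by omega), mul_zero] at h2
    conv_lhs => rw [e]
    rw [show (1 - X) * unitJacobi (m + 1) (γ + 2) α * (C (g.eval 1) + (1 - X) * q) =
      C (g.eval 1) * ((1 - X) * unitJacobi (m + 1) (γ + 2) α) +
        (1 - X) ^ 2 * (q * unitJacobi (m + 1) (γ + 2) α) by ring, map_add, h2, add_zero,
      ← smul_eq_C_mul, map_smul, smul_eq_mul]

/-- Pairing with P_m^{(γ+1,α)} can be computed twice: as its value at 1 times the unknown mean, and,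
after absorbing 1-X into the weight, from the leading coefficient of P_m^{(γ+2,α)}. -/
theorem jacobiMean_one_sub_X_mul_unitJacobi {α γ : ℝ} (hα : -1 < α) (hγ : -1 < γ) (m : ℕ) :
    jacobiMean hα hγ ((1 - X) * unitJacobi m (γ + 2) α) =
      (γ + 1) * poch (α + 1) m / poch (γ + α + 2) (m + 1) := by
  have hγ1 : -1 < γ + 1 := by linarith
  have hc : 0 < γ + α + 2 := by linarith
  have h1 := jacobiMean_one_sub_X_mul_unitJacobi_mul hα hγ (unitJacobi_natDegree_le m (γ + 1) α)
  have h2 := jacobiMean_one_sub_X_pow_mul hα hγ hγ1 (k := 1) (by norm_num)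
    (unitJacobi m (γ + 2) α * unitJacobi m (γ + 1) α)
  rw [pow_one, ← mul_assoc, h1, jacobiMean_mul_unitJacobi hα hγ1 (unitJacobi_natDegree_le _ _ _),
    unitJacobi_coeff, unitJacobi_eval_one, poch_succ_left, poch_succ_left, poch_zero, poch_zero,
    poch_add, show (m : ℝ) + (γ + 2) + α + 1 = γ + 1 + α + 2 + m by ring] at h2
  rw [poch_succ_left, show γ + α + 2 + 1 = γ + 1 + α + 2 by ring]
  have hf : (m.factorial : ℝ) ≠ 0 := by exact_mod_cast m.factorial_ne_zero
  have p1 := (poch_pos (show 0 < γ + 1 + 1 by linarith) m).ne'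
  have p2 := (poch_pos (show 0 < γ + 1 + α + 2 by linarith) m).ne'
  have p3 := (poch_pos (show 0 < γ + 1 + α + 2 + m by
    linarith [(Nat.cast_nonneg m : (0 : ℝ) ≤ m)]) m).ne'
  refine mul_left_cancel₀ (div_ne_zero p1 hf) (h2.trans ?_)
  field_simp

end Univariate

/-! ### Restriction to the two legs of the wedge -/

section Wedge

open Polynomial

/-- The restriction `f(x, 1)`. -/
noncomputable def horizontalPart : MvPolynomial (Fin 2) ℝ →ₐ[ℝ] ℝ[X] := MvPolynomial.aeval ![X, 1]

/-- The restriction `f(1, y)`. -/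
noncomputable def verticalPart : MvPolynomial (Fin 2) ℝ →ₐ[ℝ] ℝ[X] := MvPolynomial.aeval ![1, X]

@[simp] theorem horizontalPart_X_zero : horizontalPart (MvPolynomial.X 0) = X := by
  simp [horizontalPart]

@[simp] theorem horizontalPart_X_one : horizontalPart (MvPolynomial.X 1) = 1 := by
  simp [horizontalPart]

@[simp] theorem verticalPart_X_zero : verticalPart (MvPolynomial.X 0) = 1 := by
  simp [verticalPart]

@[simp] theorem verticalPart_X_one : verticalPart (MvPolynomial.X 1) = X := by
  simp [verticalPart]

@[simp] theorem horizontalPart_C (c : ℝ) : horizontalPart (MvPolynomial.C c) = C c := by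
  simp [horizontalPart]

@[simp] theorem verticalPart_C (c : ℝ) : verticalPart (MvPolynomial.C c) = C c := by
  simp [verticalPart]

theorem eval_horizontalPart (f : MvPolynomial (Fin 2) ℝ) (x : ℝ) :
    (horizontalPart f).eval x = evalXY f x 1 := by
  induction f using MvPolynomial.induction_on with
  | C a => simp [evalXY]
  | add p q hp hq => simp_all [evalXY]
  | mul_X p i hp => fin_cases i <;> simp_all [evalXY]

theorem eval_verticalPart (f : MvPolynomial (Fin 2) ℝ) (y : ℝ) :
    (verticalPart f).eval y = evalXY f 1 y := by
  induction f using MvPolynomial.induction_on with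
  | C a => simp [evalXY]
  | add p q hp hq => simp_all [evalXY]
  | mul_X p i hp => fin_cases i <;> simp_all [evalXY]

theorem natDegree_horizontalPart_le {f : MvPolynomial (Fin 2) ℝ} {n : ℕ} (hf : f.totalDegree ≤ n) :
    (horizontalPart f).natDegree ≤ n := by
  rw [← mul_one n]
  exact MvPolynomial.aeval_natDegree_le f hf _ fun i => by fin_cases i <;> simp

theorem natDegree_verticalPart_le {f : MvPolynomial (Fin 2) ℝ} {n : ℕ} (hf : f.totalDegree ≤ n) :
    (verticalPart f).natDegree ≤ n := by
  rw [← mul_one n]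
  exact MvPolynomial.aeval_natDegree_le f hf _ fun i => by fin_cases i <;> simp

theorem wedgeInner_eq_jacobiMean {α β γ : ℝ} (hα : -1 < α) (hβ : -1 < β) (hγ : -1 < γ) (σ : ℝ)
    (f g : MvPolynomial (Fin 2) ℝ) :
    wedgeInner α β γ σ f g = jacobiMean hα hγ (horizontalPart f * horizontalPart g) +
      σ * jacobiMean hβ hγ (verticalPart f * verticalPart g) := by
  simp only [wedgeInner, jacobiMean_apply, eval_mul, eval_horizontalPart, eval_verticalPart,
    mul_assoc]

theorem wedgeInner_comm (α β γ σ : ℝ) (f g : MvPolynomial (Fin 2) ℝ) :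
    wedgeInner α β γ σ f g = wedgeInner α β γ σ g f := by
  simp only [wedgeInner, mul_comm (evalXY f _ _)]

theorem totalDegree_aeval_X_le (i : Fin 2) (p : ℝ[X]) :
    (aeval (MvPolynomial.X i : MvPolynomial (Fin 2) ℝ) p).totalDegree ≤ p.natDegree := by
  rw [aeval_eq_sum_range]
  refine MvPolynomial.totalDegree_finsetSum_le fun k hk => ?_
  refine (MvPolynomial.totalDegree_smul_le _ _).trans ?_
  rw [MvPolynomial.totalDegree_X_pow]
  exact Nat.lt_succ_iff.1 (Finset.mem_range.1 hk)

/-- The polynomial without mixed terms that has the same restrictions to the wedge. -/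
noncomputable def wedgeLift (f : MvPolynomial (Fin 2) ℝ) : MvPolynomial (Fin 2) ℝ :=
  aeval (MvPolynomial.X 0) (horizontalPart f) + aeval (MvPolynomial.X 1) (verticalPart f) -
    MvPolynomial.C (evalXY f 1 1)

theorem aeval_one_eq_C_eval (p : ℝ[X]) : aeval (1 : ℝ[X]) p = C (p.eval 1) := by
  rw [← C_1, ← algebraMap_eq, aeval_algebraMap_apply, coe_aeval_eq_eval]

theorem horizontalPart_wedgeLift (f : MvPolynomial (Fin 2) ℝ) :
    horizontalPart (wedgeLift f) = horizontalPart f := by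
  simp [wedgeLift, ← aeval_algHom_apply, aeval_one_eq_C_eval, eval_verticalPart]

theorem verticalPart_wedgeLift (f : MvPolynomial (Fin 2) ℝ) :
    verticalPart (wedgeLift f) = verticalPart f := by
  simp [wedgeLift, ← aeval_algHom_apply, aeval_one_eq_C_eval, eval_horizontalPart]

theorem totalDegree_wedgeLift_le {f : MvPolynomial (Fin 2) ℝ} {m : ℕ}
    (hx : (horizontalPart f).natDegree ≤ m) (hy : (verticalPart f).natDegree ≤ m) :
    (wedgeLift f).totalDegree ≤ m := by
  refine (MvPolynomial.totalDegree_sub _ _).trans (max_le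
    ((MvPolynomial.totalDegree_add _ _).trans (max_le ?_ ?_)) (by simp))
  · exact (totalDegree_aeval_X_le _ _).trans hx
  · exact (totalDegree_aeval_X_le _ _).trans hy

/-- On a monomial, x^i y^j - (x^i + y^j - 1) = (1-x^i)(1-y^j), a multiple of (1-x)(1-y). -/
theorem sub_wedgeLift_mem (f : MvPolynomial (Fin 2) ℝ) : f - wedgeLift f ∈ wedgeIdeal := by
  induction f using MvPolynomial.induction_on' with
  | add p q hp hq =>
    have e : p + q - wedgeLift (p + q) = (p - wedgeLift p) + (q - wedgeLift q) := by
      simp only [wedgeLift, evalXY, map_add]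
      ring
    rw [e]
    exact add_mem hp hq
  | monomial s a =>
    have e : MvPolynomial.monomial s a - wedgeLift (MvPolynomial.monomial s a) =
        MvPolynomial.C a * ((1 - MvPolynomial.X 0 ^ s 0) * (1 - MvPolynomial.X 1 ^ s 1)) := by
      have h : MvPolynomial.monomial s a = MvPolynomial.C a *
          (MvPolynomial.X 0 ^ s 0 * MvPolynomial.X 1 ^ s 1) := by
        rw [MvPolynomial.monomial_eq, Finsupp.prod_fintype _ _ (by simp), Fin.prod_univ_two]
      rw [h]
      simp [wedgeLift, evalXY, MvPolynomial.algebraMap_eq]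
      ring
    rw [e]
    exact Ideal.mul_mem_left _ _ (Ideal.mem_span_singleton.2
      (mul_dvd_mul (one_sub_dvd_one_sub_pow _ _) (one_sub_dvd_one_sub_pow _ _)))

theorem mem_wedgeIdeal_iff {f : MvPolynomial (Fin 2) ℝ} :
    f ∈ wedgeIdeal ↔ horizontalPart f = 0 ∧ verticalPart f = 0 := by
  constructor
  · intro hf
    obtain ⟨h1, h2⟩ := evalXY_eq_zero_of_mem_wedgeIdeal hf
    exact ⟨Polynomial.funext fun x => by rw [eval_horizontalPart, h1, eval_zero],
      Polynomial.funext fun y => by rw [eval_verticalPart, h2, eval_zero]⟩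
  · rintro ⟨h1, h2⟩
    have h := sub_wedgeLift_mem f
    have h0 : evalXY f 1 1 = 0 := by rw [← eval_horizontalPart, h1, eval_zero]
    simpa [wedgeLift, h1, h2, h0] using h

/-! ### The polynomials `P_n` and `Q_n` on the legs -/

theorem shiftedJacobi_eq (n : ℕ) (a b : ℝ) (i : Fin 2) :
    shiftedJacobi n a b i = aeval (MvPolynomial.X i) (unitJacobi n a b) := by
  rw [shiftedJacobi, unitJacobi, aeval_comp, map_sub, map_mul, aeval_X, map_one, map_ofNat]

theorem totalDegree_shiftedJacobi_le (n : ℕ) (a b : ℝ) (i : Fin 2) :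
    (shiftedJacobi n a b i).totalDegree ≤ n := by
  rw [shiftedJacobi_eq]
  exact (totalDegree_aeval_X_le _ _).trans (unitJacobi_natDegree_le _ _ _)

@[simp] theorem horizontalPart_shiftedJacobi_zero (n : ℕ) (a b : ℝ) :
    horizontalPart (shiftedJacobi n a b 0) = unitJacobi n a b := by
  simp [shiftedJacobi_eq, ← aeval_algHom_apply]

@[simp] theorem verticalPart_shiftedJacobi_one (n : ℕ) (a b : ℝ) :
    verticalPart (shiftedJacobi n a b 1) = unitJacobi n a b := by
  simp [shiftedJacobi_eq, ← aeval_algHom_apply]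

@[simp] theorem horizontalPart_shiftedJacobi_one (n : ℕ) (a b : ℝ) :
    horizontalPart (shiftedJacobi n a b 1) = C (poch (a + 1) n / n.factorial) := by
  simp [shiftedJacobi_eq, ← aeval_algHom_apply, aeval_one_eq_C_eval, unitJacobi_eval_one]

@[simp] theorem verticalPart_shiftedJacobi_zero (n : ℕ) (a b : ℝ) :
    verticalPart (shiftedJacobi n a b 0) = C (poch (a + 1) n / n.factorial) := by
  simp [shiftedJacobi_eq, ← aeval_algHom_apply, aeval_one_eq_C_eval, unitJacobi_eval_one]

/-- The summand in y contributes its value at 1, which depends on γ and n only and is cancelled by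
the binomial constant. -/
theorem horizontalPart_wedgeP (α β γ : ℝ) (n : ℕ) :
    horizontalPart (wedgeP α β γ n) = unitJacobi n γ α := by
  simp [wedgeP, ringChoose_eq_poch]

theorem verticalPart_wedgeP (α β γ : ℝ) (n : ℕ) :
    verticalPart (wedgeP α β γ n) = unitJacobi n γ β := by
  simp [wedgeP, ringChoose_eq_poch]

theorem totalDegree_wedgeP_le (α β γ : ℝ) (n : ℕ) : (wedgeP α β γ n).totalDegree ≤ n :=
  (MvPolynomial.totalDegree_sub _ _).trans (max_le
    ((MvPolynomial.totalDegree_add _ _).trans (max_le (totalDegree_shiftedJacobi_le _ _ _ _)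
      (totalDegree_shiftedJacobi_le _ _ _ _))) (by simp))

/-- The restriction of `Q_{m+1}` to the leg with exponent `α`, up to sign and the factor `σ⁻¹` on
the second leg. -/
noncomputable def legQ (m : ℕ) (γ α : ℝ) : ℝ[X] :=
  C (poch (γ + α + 2) (m + 1) / poch (α + 1) m) * ((1 - X) * unitJacobi m (γ + 2) α)

theorem horizontalPart_wedgeQ (α β γ σ : ℝ) (m : ℕ) :
    horizontalPart (wedgeQ α β γ σ (m + 1)) = legQ m γ α := by
  simp [wedgeQ, legQ]

theorem verticalPart_wedgeQ (α β γ σ : ℝ) (m : ℕ) :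
    verticalPart (wedgeQ α β γ σ (m + 1)) = -(σ⁻¹ • legQ m γ β) := by
  simp [wedgeQ, legQ, smul_eq_C_mul, mul_assoc]

theorem totalDegree_wedgeQ_le (α β γ σ : ℝ) (m : ℕ) :
    (wedgeQ α β γ σ (m + 1)).totalDegree ≤ m + 1 := by
  have h : ∀ (i : Fin 2) (c b : ℝ), (MvPolynomial.C c * ((1 - MvPolynomial.X i) *
      shiftedJacobi m (γ + 2) b i)).totalDegree ≤ m + 1 := fun i c b => by
    refine (MvPolynomial.totalDegree_mul _ _).trans ?_
    rw [MvPolynomial.totalDegree_C, zero_add, add_comm m 1]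
    refine (MvPolynomial.totalDegree_mul _ _).trans (add_le_add ?_
      (totalDegree_shiftedJacobi_le _ _ _ _))
    exact (MvPolynomial.totalDegree_sub _ _).trans (max_le (by simp) (by simp))
  exact (MvPolynomial.totalDegree_sub _ _).trans (max_le (h _ _ _) (h _ _ _))

theorem legQ_eval_one (m : ℕ) (γ α : ℝ) : (legQ m γ α).eval 1 = 0 := by simp [legQ]

theorem legQ_natDegree_le (m : ℕ) (γ α : ℝ) : (legQ m γ α).natDegree ≤ m + 1 :=
  (natDegree_C_mul_le _ _).trans (natDegree_one_sub_X_mul_le (unitJacobi_natDegree_le _ _ _))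

theorem legQ_coeff (m : ℕ) (γ α : ℝ) : (legQ m γ α).coeff (m + 1) =
    -(poch (γ + α + 2) (m + 1) / poch (α + 1) m * (unitJacobi m (γ + 2) α).coeff m) := by
  rw [legQ, coeff_C_mul, coeff_one_sub_X_mul (unitJacobi_natDegree_le _ _ _), mul_neg]

/-- The factor 1-X supplies the sign, which later makes the 2×2 system for the top coefficients
nonsingular. -/
theorem legQ_coeff_neg {α γ : ℝ} (hα : -1 < α) (hγ : -1 < γ) (m : ℕ) :
    (legQ m γ α).coeff (m + 1) < 0 := by
  have hm : (0 : ℝ) ≤ m := m.cast_nonneg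
  rw [legQ_coeff, neg_lt_zero]
  exact mul_pos (div_pos (poch_pos (by linarith) _) (poch_pos (by linarith) _))
    (unitJacobi_coeff_pos (by linarith))

/-- The Pochhammer prefactor of `legQ` is chosen to make this constant independent of α, so that the
two legs can cancel. -/
theorem jacobiMean_legQ_mul {α γ : ℝ} (hα : -1 < α) (hγ : -1 < γ) {m : ℕ} {g : ℝ[X]}
    (hg : g.natDegree ≤ m) : jacobiMean hα hγ (legQ m γ α * g) = (γ + 1) * g.eval 1 := by
  rw [legQ, ← smul_eq_C_mul, smul_mul_assoc, map_smul,
    jacobiMean_one_sub_X_mul_unitJacobi_mul hα hγ hg, jacobiMean_one_sub_X_mul_unitJacobi,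
    smul_eq_mul]
  have := (poch_pos (show 0 < γ + α + 2 by linarith) (m + 1)).ne'
  have := (poch_pos (show 0 < α + 1 by linarith) m).ne'
  field_simp

theorem jacobiMean_unitJacobi_mul_legQ {α γ : ℝ} (hα : -1 < α) (hγ : -1 < γ) (m : ℕ) :
    jacobiMean hα hγ (unitJacobi (m + 1) γ α * legQ m γ α) =
      -(poch (γ + 1) (m + 1) * (α + m + 1) / (m.factorial * (2 * m + γ + α + 3))) := by
  have hm : (0 : ℝ) ≤ m := m.cast_nonneg
  rw [mul_comm, jacobiMean_mul_unitJacobi hα hγ (legQ_natDegree_le _ _ _), legQ_coeff,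
    unitJacobi_coeff, poch_succ (α + 1), ← add_assoc (m + 1), poch_succ (γ + α + 2) (m + 1 + m),
    poch_add (γ + α + 2) (m + 1) m,
    show (m : ℝ) + (γ + 2) + α + 1 = γ + α + 2 + (m + 1 : ℕ) by push_cast; ring]
  have := (poch_pos (show 0 < γ + α + 2 by linarith) (m + 1)).ne'
  have := (poch_pos (show 0 < α + 1 by linarith) m).ne'
  have := (poch_pos (show 0 < γ + α + 2 + (m + 1 : ℕ) by push_cast; linarith) m).ne'
  have hf : (m.factorial : ℝ) ≠ 0 := by exact_mod_cast m.factorial_ne_zero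
  have h3 : 2 * m + γ + α + 3 ≠ 0 := by linarith
  have e : γ + α + 2 + (m + 1 + m : ℕ) = 2 * m + γ + α + 3 := by push_cast; ring
  rw [e]
  field_simp
  ring

theorem jacobiMean_legQ_sq {α γ : ℝ} (hα : -1 < α) (hγ : -1 < γ) (m : ℕ) :
    jacobiMean hα hγ (legQ m γ α * legQ m γ α) =
      poch (γ + 1) 2 * poch (α + γ + 2) (m + 1) ^ 2 /
        (poch (α + γ + 2) 2 * poch (α + 1) m ^ 2) * jacobiNormSq m α (γ + 2) := by
  have h := jacobiMean_one_sub_X_pow_mul hα hγ (γ' := γ + 2) (by linarith) (k := 2) (by norm_num)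
    (unitJacobi m (γ + 2) α * unitJacobi m (γ + 2) α)
  rw [jacobiMean_unitJacobi_sq] at h
  rw [legQ, ← smul_eq_C_mul, smul_mul_smul_comm, map_smul,
    show (1 - X) * unitJacobi m (γ + 2) α * ((1 - X) * unitJacobi m (γ + 2) α) =
      (1 - X) ^ 2 * (unitJacobi m (γ + 2) α * unitJacobi m (γ + 2) α) by ring, h, smul_eq_mul,
    add_comm α γ]
  ring

end Wedge

/-! ### The orthogonal basis -/

theorem wedgeP_mem {α β γ : ℝ} (hα : -1 < α) (hβ : -1 < β) (hγ : -1 < γ)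
    (σ : ℝ) (n : ℕ) : wedgeP α β γ n ∈ wedgeOrthPolys hα hβ hγ σ n := by
  refine ⟨totalDegree_wedgeP_le α β γ n, fun g hg => ?_⟩
  -- Truncated subtraction is harmless: `hg` forces n ≥ 1.
  have hg' : g.totalDegree ≤ n - 1 := by omega
  have hx := natDegree_horizontalPart_le hg'
  have hy := natDegree_verticalPart_le hg'
  rw [wedgeInner_comm, wedgeInner_eq_jacobiMean hα hβ hγ, horizontalPart_wedgeP,
    verticalPart_wedgeP, jacobiMean_mul_unitJacobi_eq_zero hα hγ (by omega),
    jacobiMean_mul_unitJacobi_eq_zero hβ hγ (by omega), mul_zero, add_zero]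

/-- The legs contribute (γ+1)g(1,1) and -σσ⁻¹(γ+1)g(1,1). -/
theorem wedgeQ_mem {α β γ σ : ℝ} (hα : -1 < α) (hβ : -1 < β) (hγ : -1 < γ)
    (hσ : σ ≠ 0) (m : ℕ) :
    wedgeQ α β γ σ (m + 1) ∈ wedgeOrthPolys hα hβ hγ σ (m + 1) := by
  refine ⟨totalDegree_wedgeQ_le α β γ σ m, fun g hg => ?_⟩
  have hg' : g.totalDegree ≤ m := by omega
  rw [wedgeInner_eq_jacobiMean hα hβ hγ, horizontalPart_wedgeQ, verticalPart_wedgeQ,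
    jacobiMean_legQ_mul hα hγ (natDegree_horizontalPart_le hg'), neg_mul, smul_mul_assoc, map_neg,
    map_smul, jacobiMean_legQ_mul hβ hγ (natDegree_verticalPart_le hg'), eval_horizontalPart,
    eval_verticalPart, smul_eq_mul]
  field_simp
  ring

theorem wedgeR_eq (α β γ σ : ℝ) (n : ℕ) :
    wedgeR α β γ σ n = wedgeQ α β γ σ n + (-(wedgeInner α β γ σ (wedgeP α β γ n)
      (wedgeQ α β γ σ n) / (jacobiNormSq n α γ + σ * jacobiNormSq n β γ))) • wedgeP α β γ n := by
  rw [wedgeR, ← MvPolynomial.smul_eq_C_mul, neg_smul, sub_eq_add_neg]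

theorem wedgeR_mem {α β γ σ : ℝ} (hα : -1 < α) (hβ : -1 < β) (hγ : -1 < γ)
    (hσ : σ ≠ 0) (m : ℕ) :
    wedgeR α β γ σ (m + 1) ∈ wedgeOrthPolys hα hβ hγ σ (m + 1) := by
  rw [wedgeR_eq]
  exact add_mem (wedgeQ_mem hα hβ hγ hσ m) (Submodule.smul_mem _ _ (wedgeP_mem hα hβ hγ σ _))

theorem wedgeInner_wedgeP_self {α β γ : ℝ} (hα : -1 < α) (hβ : -1 < β) (hγ : -1 < γ)
    (σ : ℝ) (n : ℕ) : wedgeInner α β γ σ (wedgeP α β γ n) (wedgeP α β γ n) =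
      jacobiNormSq n α γ + σ * jacobiNormSq n β γ := by
  rw [wedgeInner_eq_jacobiMean hα hβ hγ, horizontalPart_wedgeP, verticalPart_wedgeP,
    jacobiMean_unitJacobi_sq, jacobiMean_unitJacobi_sq]

/-- A zero norm would make the Jacobi polynomial vanish, but its value at 1 is positive. This avoids
the nonvanishing condition of the closed form. -/
theorem jacobiNormSq_pos {α γ : ℝ} (hα : -1 < α) (hγ : -1 < γ) (n : ℕ) :
    0 < jacobiNormSq n α γ := by
  rw [← jacobiMean_unitJacobi_sq hα hγ]
  refine (jacobiMean_sq_nonneg hα hγ _).lt_of_ne' fun h => ?_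
  have h1 := unitJacobi_eval_one n γ α
  rw [eq_zero_of_jacobiMean_sq_eq_zero hα hγ h, Polynomial.eval_zero] at h1
  exact (div_pos (poch_pos (by linarith) n) (by exact_mod_cast n.factorial_pos)).ne h1

theorem jacobiNormSq_add_pos {α β γ σ : ℝ} (hα : -1 < α) (hβ : -1 < β) (hγ : -1 < γ)
    (hσ : 0 < σ) (n : ℕ) : 0 < jacobiNormSq n α γ + σ * jacobiNormSq n β γ :=
  add_pos (jacobiNormSq_pos hα hγ n) (mul_pos hσ (jacobiNormSq_pos hβ hγ n))

/-- With a, b the two linear denominators, (β+m+1)a - (α+m+1)b = (β-α)(γ+m+2), and γ+m+2 is the last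
factor of (γ+1)_{m+2}. -/
theorem wedgeInner_wedgeP_wedgeQ {α β γ σ : ℝ} (hα : -1 < α) (hβ : -1 < β) (hγ : -1 < γ)
    (hσ : σ ≠ 0) (m : ℕ) :
    wedgeInner α β γ σ (wedgeP α β γ (m + 1)) (wedgeQ α β γ σ (m + 1)) =
      (β - α) * poch (γ + 1) (m + 2) /
        ((2 * m + γ + α + 3) * (2 * m + γ + β + 3) * m.factorial) := by
  have hm : (0 : ℝ) ≤ m := m.cast_nonneg
  rw [wedgeInner_eq_jacobiMean hα hβ hγ, horizontalPart_wedgeP, verticalPart_wedgeP,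
    horizontalPart_wedgeQ, verticalPart_wedgeQ, mul_neg, mul_smul_comm, map_neg, map_smul,
    jacobiMean_unitJacobi_mul_legQ, jacobiMean_unitJacobi_mul_legQ, smul_eq_mul,
    poch_succ (γ + 1) (m + 1)]
  have hf : (m.factorial : ℝ) ≠ 0 := by exact_mod_cast m.factorial_ne_zero
  obtain ⟨a, ha⟩ : ∃ a, a = 2 * m + γ + α + 3 := ⟨_, rfl⟩
  obtain ⟨b, hb⟩ : ∃ b, b = 2 * m + γ + β + 3 := ⟨_, rfl⟩
  have ha0 : a ≠ 0 := by linarith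
  have hb0 : b ≠ 0 := by linarith
  rw [← ha, ← hb]
  push_cast
  field_simp
  rw [ha, hb]
  ring

theorem wedgeInner_wedgeQ_self {α β γ σ : ℝ} (hα : -1 < α) (hβ : -1 < β) (hγ : -1 < γ)
    (hσ : σ ≠ 0) (m : ℕ) :
    wedgeInner α β γ σ (wedgeQ α β γ σ (m + 1)) (wedgeQ α β γ σ (m + 1)) =
      poch (γ + 1) 2 * poch (α + γ + 2) (m + 1) ^ 2 /
          (poch (α + γ + 2) 2 * poch (α + 1) m ^ 2) * jacobiNormSq m α (γ + 2) +
        σ⁻¹ * (poch (γ + 1) 2 * poch (β + γ + 2) (m + 1) ^ 2 /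
          (poch (β + γ + 2) 2 * poch (β + 1) m ^ 2)) * jacobiNormSq m β (γ + 2) := by
  rw [wedgeInner_eq_jacobiMean hα hβ hγ, horizontalPart_wedgeQ, verticalPart_wedgeQ, neg_mul_neg,
    smul_mul_smul_comm, map_smul, jacobiMean_legQ_sq, jacobiMean_legQ_sq, smul_eq_mul,
    ← mul_assoc σ, mul_inv_cancel_left₀ hσ, mul_assoc σ⁻¹]

theorem wedgeInner_wedgeR_left {α β γ : ℝ} (hα : -1 < α) (hβ : -1 < β) (hγ : -1 < γ)
    (σ : ℝ) (n : ℕ) (g : MvPolynomial (Fin 2) ℝ) :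
    wedgeInner α β γ σ (wedgeR α β γ σ n) g = wedgeInner α β γ σ (wedgeQ α β γ σ n) g -
      wedgeInner α β γ σ (wedgeP α β γ n) (wedgeQ α β γ σ n) /
        (jacobiNormSq n α γ + σ * jacobiNormSq n β γ) * wedgeInner α β γ σ (wedgeP α β γ n) g := by
  rw [wedgeR_eq, wedgeInner_add_left hα hβ hγ, wedgeInner_smul_left]
  ring

theorem wedgeInner_wedgeP_wedgeR {α β γ σ : ℝ} (hα : -1 < α) (hβ : -1 < β) (hγ : -1 < γ)
    (hσ : 0 < σ) (n : ℕ) : wedgeInner α β γ σ (wedgeP α β γ n) (wedgeR α β γ σ n) = 0 := by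
  rw [wedgeInner_comm, wedgeInner_wedgeR_left hα hβ hγ, wedgeInner_wedgeP_self hα hβ hγ,
    div_mul_cancel₀ _ (jacobiNormSq_add_pos hα hβ hγ hσ n).ne', wedgeInner_comm, sub_self]

/-- Since R_n is orthogonal to P_n, ⟨R_n,R_n⟩ = ⟨R_n,Q_n⟩. -/
theorem wedgeInner_wedgeR_self {α β γ σ : ℝ} (hα : -1 < α) (hβ : -1 < β) (hγ : -1 < γ)
    (hσ : 0 < σ) (n : ℕ) :
    wedgeInner α β γ σ (wedgeR α β γ σ n) (wedgeR α β γ σ n) =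
      wedgeInner α β γ σ (wedgeQ α β γ σ n) (wedgeQ α β γ σ n) -
        wedgeInner α β γ σ (wedgeP α β γ n) (wedgeQ α β γ σ n) ^ 2 /
          wedgeInner α β γ σ (wedgeP α β γ n) (wedgeP α β γ n) := by
  rw [wedgeInner_wedgeR_left hα hβ hγ, wedgeInner_wedgeP_wedgeR hα hβ hγ hσ, mul_zero, sub_zero,
    wedgeInner_comm, wedgeInner_wedgeR_left hα hβ hγ, wedgeInner_wedgeP_self hα hβ hγ]
  ring

/-- The form is definite modulo the ideal. -/
theorem mem_wedgeIdeal_of_wedgeInner_self_eq_zero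
    {α β γ σ : ℝ} (hα : -1 < α) (hβ : -1 < β) (hγ : -1 < γ) (hσ : 0 < σ)
    {f : MvPolynomial (Fin 2) ℝ} (hf : wedgeInner α β γ σ f f = 0) : f ∈ wedgeIdeal := by
  rw [wedgeInner_eq_jacobiMean hα hβ hγ] at hf
  have hx := jacobiMean_sq_nonneg hα hγ (horizontalPart f)
  have hy := mul_nonneg hσ.le (jacobiMean_sq_nonneg hβ hγ (verticalPart f))
  refine mem_wedgeIdeal_iff.2 ⟨eq_zero_of_jacobiMean_sq_eq_zero hα hγ (by linarith),
    eq_zero_of_jacobiMean_sq_eq_zero hβ hγ ?_⟩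
  exact (mul_eq_zero.1 (show σ * _ = 0 by linarith)).resolve_left hσ.ne'

/-- An orthogonal polynomial of degree `m + 1` both of whose restrictions have degree at most `m`
is trivial. -/
theorem mem_wedgeIdeal_of_mem_wedgeOrthPolys
    {α β γ σ : ℝ} (hα : -1 < α) (hβ : -1 < β) (hγ : -1 < γ) (hσ : 0 < σ) {m : ℕ}
    {f : MvPolynomial (Fin 2) ℝ} (hf : f ∈ wedgeOrthPolys hα hβ hγ σ (m + 1))
    (hx : (horizontalPart f).natDegree ≤ m) (hy : (verticalPart f).natDegree ≤ m) :
    f ∈ wedgeIdeal := by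
  refine mem_wedgeIdeal_of_wedgeInner_self_eq_zero hα hβ hγ hσ ?_
  -- The lift has total degree at most m, so it is an admissible test polynomial, and the form
  -- cannot distinguish it from f.
  have h := hf.2 (wedgeLift f) (Nat.lt_succ_of_le (totalDegree_wedgeLift_le hx hy))
  rwa [wedgeInner_eq_jacobiMean hα hβ hγ, horizontalPart_wedgeLift, verticalPart_wedgeLift,
    ← wedgeInner_eq_jacobiMean hα hβ hγ] at h

theorem natDegree_le_of_coeff_succ_eq_zero {p : Polynomial ℝ} {m : ℕ} (hp : p.natDegree ≤ m + 1)
    (h : p.coeff (m + 1) = 0) : p.natDegree ≤ m :=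
  Polynomial.natDegree_le_iff_coeff_eq_zero.2 fun N hN => by
    rcases (Nat.succ_le_of_lt hN).eq_or_lt with rfl | hN'
    · exact h
    · exact Polynomial.coeff_eq_zero_of_natDegree_lt (hp.trans_lt hN')

/-- Orthogonal polynomials of degree `m + 1` are combinations of `P_{m+1}` and `Q_{m+1}` modulo the
ideal. -/
theorem exists_sub_mem_wedgeIdeal
    {α β γ σ : ℝ} (hα : -1 < α) (hβ : -1 < β) (hγ : -1 < γ) (hσ : 0 < σ) {m : ℕ}
    {f : MvPolynomial (Fin 2) ℝ} (hf : f ∈ wedgeOrthPolys hα hβ hγ σ (m + 1)) :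
    ∃ a b : ℝ, f - (a • wedgeP α β γ (m + 1) + b • wedgeQ α β γ σ (m + 1)) ∈ wedgeIdeal := by
  have hm : (0 : ℝ) ≤ m := m.cast_nonneg
  set u := (horizontalPart f).coeff (m + 1)
  set v := (verticalPart f).coeff (m + 1)
  have pα := unitJacobi_coeff_pos (n := m + 1) (a := γ) (b := α) (by push_cast; linarith)
  have pβ := unitJacobi_coeff_pos (n := m + 1) (a := γ) (b := β) (by push_cast; linarith)
  have qα := legQ_coeff_neg hα hγ m
  have qβ := mul_neg_of_pos_of_neg (inv_pos.2 hσ) (legQ_coeff_neg hβ hγ m)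
  have hX := horizontalPart_wedgeP α β γ (m + 1)
  have hY := verticalPart_wedgeP α β γ (m + 1)
  have hX' := horizontalPart_wedgeQ α β γ σ m
  have hY' := verticalPart_wedgeQ α β γ σ m
  set kα := (unitJacobi (m + 1) γ α).coeff (m + 1)
  set kβ := (unitJacobi (m + 1) γ β).coeff (m + 1)
  set lα := (legQ m γ α).coeff (m + 1)
  set lβ := σ⁻¹ * (legQ m γ β).coeff (m + 1) with hlβ
  obtain ⟨a, b, ha, hb⟩ : ∃ a b, u = a * kα + b * lα ∧ v = a * kβ + b * -lβ := by
    -- Cramer's rule; D is minus the determinant and is negative, because the k's are positive and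
    -- the l's negative.
    obtain ⟨D, hD⟩ : ∃ D, D = kα * lβ + lα * kβ := ⟨_, rfl⟩
    have hD0 : D ≠ 0 := by
      linarith [mul_neg_of_pos_of_neg pα qβ, mul_neg_of_neg_of_pos qα pβ]
    refine ⟨(lβ * u + lα * v) / D, (kβ * u - kα * v) / D, ?_, ?_⟩
    · field_simp
      rw [hD]
      ring
    · field_simp
      rw [hD]
      ring
  have hr := sub_mem hf (add_mem
    (Submodule.smul_mem _ a (wedgeP_mem hα hβ hγ σ (m + 1)))
    (Submodule.smul_mem _ b (wedgeQ_mem hα hβ hγ hσ.ne' m)))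
  refine ⟨a, b, mem_wedgeIdeal_of_mem_wedgeOrthPolys hα hβ hγ hσ hr
    (natDegree_le_of_coeff_succ_eq_zero (natDegree_horizontalPart_le hr.1) ?_)
    (natDegree_le_of_coeff_succ_eq_zero (natDegree_verticalPart_le hr.1) ?_)⟩
  · simp only [map_sub, map_add, map_smul, hX, hX', Polynomial.coeff_sub, Polynomial.coeff_add,
      Polynomial.coeff_smul, smul_eq_mul]
    exact sub_eq_zero.2 ha
  · simp only [map_sub, map_add, map_smul, hY, hY', Polynomial.coeff_sub, Polynomial.coeff_add,
      Polynomial.coeff_smul, Polynomial.coeff_neg, smul_eq_mul, ← hlβ]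
    exact sub_eq_zero.2 hb

/-- At the corner Q vanishes and P does not, so a = 0; the top coefficient on the horizontal leg
then gives b = 0. -/
theorem eq_zero_of_smul_add_smul_mem_wedgeIdeal
    {α β γ σ : ℝ} (hα : -1 < α) (hγ : -1 < γ) {m : ℕ} {a b : ℝ}
    (h : a • wedgeP α β γ (m + 1) + b • wedgeQ α β γ σ (m + 1) ∈ wedgeIdeal) :
    a = 0 ∧ b = 0 := by
  have hx := (mem_wedgeIdeal_iff.1 h).1
  rw [map_add, map_smul, map_smul, horizontalPart_wedgeP, horizontalPart_wedgeQ] at hx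
  have ha : a = 0 := by
    have h1 := congrArg (Polynomial.eval 1) hx
    rw [Polynomial.eval_add, Polynomial.eval_smul, Polynomial.eval_smul, legQ_eval_one, smul_zero,
      add_zero, Polynomial.eval_zero, unitJacobi_eval_one] at h1
    exact (mul_eq_zero.1 h1).resolve_right
      (div_pos (poch_pos (by linarith) _) (by exact_mod_cast Nat.factorial_pos _)).ne'
  refine ⟨ha, ?_⟩
  have h1 := congrArg (fun p => Polynomial.coeff p (m + 1)) hx
  simp only [ha, zero_smul, zero_add, Polynomial.coeff_smul, Polynomial.coeff_zero] at h1
  exact (mul_eq_zero.1 h1).resolve_right (legQ_coeff_neg hα hγ m).ne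

theorem exists_basis_wedgeOrthSpace
    {α β γ σ : ℝ} (hα : -1 < α) (hβ : -1 < β) (hγ : -1 < γ) (hσ : 0 < σ) (m : ℕ) :
    ∃ b : Module.Basis (Fin 2) ℝ (wedgeOrthSpace hα hβ hγ σ (m + 1)),
      (b 0 : MvPolynomial (Fin 2) ℝ ⧸ wedgeIdeal) =
        Ideal.Quotient.mk wedgeIdeal (wedgeP α β γ (m + 1)) ∧
      (b 1 : MvPolynomial (Fin 2) ℝ ⧸ wedgeIdeal) =
        Ideal.Quotient.mk wedgeIdeal (wedgeR α β γ σ (m + 1)) := by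
  set π := (Ideal.Quotient.mkₐ ℝ wedgeIdeal).toLinearMap
  have hker : ∀ f, π f = 0 ↔ f ∈ wedgeIdeal := fun f => Ideal.Quotient.eq_zero_iff_mem
  -- The passage from (P,Q) to (P,R) is unipotent, so independence and spanning carry over whatever
  -- κ is.
  obtain ⟨κ, hκ⟩ : ∃ κ : ℝ, wedgeR α β γ σ (m + 1) =
      wedgeQ α β γ σ (m + 1) + κ • wedgeP α β γ (m + 1) := ⟨_, wedgeR_eq α β γ σ (m + 1)⟩
  let P : wedgeOrthSpace hα hβ hγ σ (m + 1) :=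
    ⟨π (wedgeP α β γ (m + 1)), Submodule.mem_map_of_mem (wedgeP_mem hα hβ hγ σ (m + 1))⟩
  let R : wedgeOrthSpace hα hβ hγ σ (m + 1) :=
    ⟨π (wedgeR α β γ σ (m + 1)), Submodule.mem_map_of_mem (wedgeR_mem hα hβ hγ hσ.ne' m)⟩
  have hli : LinearIndependent ℝ ![P, R] := by
    refine LinearIndependent.pair_iff.2 fun s t h => ?_
    have h' : π (s • wedgeP α β γ (m + 1) + t • wedgeR α β γ σ (m + 1)) = 0 := by
      rw [map_add, map_smul, map_smul]
      exact congrArg Subtype.val h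
    rw [hker, hκ, show s • wedgeP α β γ (m + 1) +
      t • (wedgeQ α β γ σ (m + 1) + κ • wedgeP α β γ (m + 1)) =
      (s + t * κ) • wedgeP α β γ (m + 1) + t • wedgeQ α β γ σ (m + 1) by module] at h'
    obtain ⟨h1, h2⟩ := eq_zero_of_smul_add_smul_mem_wedgeIdeal hα hγ h'
    exact ⟨by simpa [h2] using h1, h2⟩
  have hsp : ⊤ ≤ Submodule.span ℝ (Set.range ![P, R]) := by
    rintro ⟨_, f, hf, rfl⟩ -
    obtain ⟨a, b, hab⟩ := exists_sub_mem_wedgeIdeal hα hβ hγ hσ hf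
    rw [Matrix.range_cons, Matrix.range_cons, Matrix.range_empty, Set.union_empty,
      Set.singleton_union]
    refine Submodule.mem_span_pair.2 ⟨a - b * κ, b, Subtype.ext ?_⟩
    change (a - b * κ) • π (wedgeP α β γ (m + 1)) + b • π (wedgeR α β γ σ (m + 1)) = π f
    rw [← hker, map_sub, sub_eq_zero] at hab
    rw [hab, hκ]
    simp only [map_add, map_smul]
    module
  refine ⟨Module.Basis.mk hli hsp, ?_, ?_⟩
  · rw [Module.Basis.mk_apply]
    rfl
  · rw [Module.Basis.mk_apply]
    rfl

theorem corollary2p5 (α β γ σ : ℝ) (hα : -1 < α) (hβ : -1 < β) (hγ : -1 < γ) (hσ : 0 < σ)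
    (hαβ : α ≠ β) (n : ℕ) (hn : 1 ≤ n) :
    -- `P_n` and `R_n` are orthogonal polynomials of degree `n`, mutually orthogonal
    wedgeP α β γ n ∈ wedgeOrthPolys hα hβ hγ σ n ∧
    wedgeR α β γ σ n ∈ wedgeOrthPolys hα hβ hγ σ n ∧
    wedgeInner α β γ σ (wedgeP α β γ n) (wedgeR α β γ σ n) = 0 ∧
    -- they form a basis of the space of orthogonal polynomials of degree `n` in the quotient
    (∃ b : Module.Basis (Fin 2) ℝ (wedgeOrthSpace hα hβ hγ σ n),
      (b 0 : MvPolynomial (Fin 2) ℝ ⧸ wedgeIdeal) =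
        Ideal.Quotient.mk wedgeIdeal (wedgeP α β γ n) ∧
      (b 1 : MvPolynomial (Fin 2) ℝ ⧸ wedgeIdeal) =
        Ideal.Quotient.mk wedgeIdeal (wedgeR α β γ σ n)) ∧
    -- the norm of `R_n`
    wedgeInner α β γ σ (wedgeR α β γ σ n) (wedgeR α β γ σ n) =
      wedgeInner α β γ σ (wedgeQ α β γ σ n) (wedgeQ α β γ σ n) -
        wedgeInner α β γ σ (wedgeP α β γ n) (wedgeQ α β γ σ n) ^ 2 /
          wedgeInner α β γ σ (wedgeP α β γ n) (wedgeP α β γ n) ∧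
    -- the explicit values of the inner products in it
    wedgeInner α β γ σ (wedgeP α β γ n) (wedgeQ α β γ σ n) =
      (β - α) * poch (γ + 1) (n + 1) /
        ((2 * n + γ + α + 1) * (2 * n + γ + β + 1) * ((n - 1).factorial : ℝ)) ∧
    wedgeInner α β γ σ (wedgeP α β γ n) (wedgeP α β γ n) =
      jacobiNormSq n α γ + σ * jacobiNormSq n β γ ∧
    wedgeInner α β γ σ (wedgeQ α β γ σ n) (wedgeQ α β γ σ n) =
      poch (γ + 1) 2 * poch (α + γ + 2) n ^ 2 /
          (poch (α + γ + 2) 2 * poch (α + 1) (n - 1) ^ 2) * jacobiNormSq (n - 1) α (γ + 2) +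
        σ⁻¹ * (poch (γ + 1) 2 * poch (β + γ + 2) n ^ 2 /
          (poch (β + γ + 2) 2 * poch (β + 1) (n - 1) ^ 2)) * jacobiNormSq (n - 1) β (γ + 2) ∧
    jacobiNormSq n α γ = jacobiNormValue n α γ ∧
    jacobiNormSq n β γ = jacobiNormValue n β γ ∧
    jacobiNormSq (n - 1) α (γ + 2) = jacobiNormValue (n - 1) α (γ + 2) ∧
    jacobiNormSq (n - 1) β (γ + 2) = jacobiNormValue (n - 1) β (γ + 2) := by
  obtain ⟨m, rfl⟩ : ∃ m, n = m + 1 := ⟨n - 1, by omega⟩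
  have hm : (0 : ℝ) ≤ m := m.cast_nonneg
  refine ⟨wedgeP_mem hα hβ hγ σ (m + 1), wedgeR_mem hα hβ hγ hσ.ne' m,
    wedgeInner_wedgeP_wedgeR hα hβ hγ hσ (m + 1), exists_basis_wedgeOrthSpace hα hβ hγ hσ m,
    wedgeInner_wedgeR_self hα hβ hγ hσ (m + 1), ?_, wedgeInner_wedgeP_self hα hβ hγ σ (m + 1),
    wedgeInner_wedgeQ_self hα hβ hγ hσ.ne' m,
    jacobiNormSq_eq hα hγ _ ?_, jacobiNormSq_eq hβ hγ _ ?_,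
    jacobiNormSq_eq hα (by linarith) _ ?_, jacobiNormSq_eq hβ (by linarith) _ ?_⟩
  · rw [wedgeInner_wedgeP_wedgeQ hα hβ hγ hσ.ne', add_tsub_cancel_right]
    push_cast
    ring_nf
  -- The remaining denominators 2k+c+a+1 are positive: k = m+1 in the first two cases, c = γ+2 in
  -- the last two.
  · push_cast
    linarith
  · push_cast
    linarith
  · rw [add_tsub_cancel_right]
    linarith
  · rw [add_tsub_cancel_right]
    linarith
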